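/- Let $(J,\pi)$ be a standard probability space and let $W:J\times J\to[0,1]$ be a graphon on it, i.e. a symmetric function, measurable with respect to the completed product measure, all of whose sections $W(x,\cdot)$ are ($\pi$-completion) measurable. Put $$r_W(x,y)=\int_J|W(x,z)-W(y,z)|\,d\pi(z),\qquad (W\circ W)(x,y)=\int_J W(x,z)W(z,y)\,d\pi(z),\qquad \overline r_W=r_{W\circ W},$$ and let $\overline J$ be the completion of $J$ with respect to $\overline r_W$. Suppose that $(J,W)$ is pure: $(J,r_W)$ is a complete metric space and every nonempty open subset of it has positive $\pi$-measure. Call a measure preserving bijection $\sigma:J\to J$ an automorphism of $(J,W)$ if for every $x\in J$ one has $W(\sigma(x),\sigma(y))=W(x,y)$ for $\pi$-almost all $y\in J$. If the automorphism group of $(J,W)$ is transitive on $J$ (for all $x,y\in J$ some automorphism maps $x$ to $y$), then the metric space $(J,r_W)$ is compact and $\overline J=J$, i.e. the canonical map $J\to\overline J$ is a bijection. -/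

import Mathlib

open MeasureTheory

/-- `π` makes `J` a standard probability space: up to null sets, `(J, π)` is isomorphic to a
Borel probability measure `ν` on `ℝ`. Measurability of the two maps is understood with respect to
the completions, so this covers both a standard Borel `J` and a complete (Lebesgue) space `J`. -/
class IsStandardProbabilitySpace {J : Type*} [MeasurableSpace J] (π : Measure J) : Prop
    extends IsProbabilityMeasure π where
  exists_iso_mod_null : ∃ (ν : Measure ℝ) (f : J → ℝ) (g : ℝ → J),
    IsProbabilityMeasure ν ∧
    (∀ s, MeasurableSet s → NullMeasurableSet (f ⁻¹' s) π ∧ π (f ⁻¹' s) = ν s) ∧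
    (∀ s, MeasurableSet s → NullMeasurableSet (g ⁻¹' s) ν ∧ ν (g ⁻¹' s) = π s) ∧
    (∀ᵐ x ∂π, g (f x) = x) ∧ (∀ᵐ t ∂ν, f (g t) = t)

/-- A graphon on `(J, π)`: a symmetric function `W : J × J → [0,1]`, measurable with respect to
the completion of the product measure, all of whose one-variable sections are measurable
with respect to the completion of `π`. -/
structure Graphon {J : Type*} [MeasurableSpace J] (π : Measure J) where
  toFun : J → J → ℝ
  symm : ∀ x y, toFun x y = toFun y x
  mem_Icc : ∀ x y, toFun x y ∈ Set.Icc (0 : ℝ) 1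
  aemeasurable : AEMeasurable (Function.uncurry toFun) (π.prod π)
  aemeasurable_section : ∀ x, AEMeasurable (toFun x) π

namespace Graphon

noncomputable section

variable {J : Type*} [MeasurableSpace J] {π : Measure J}

/-- The neighborhood distance `r_W(x,y) = ∫ |W(x,z) - W(y,z)| dπ(z)`. -/
def nbhdDist (W : Graphon π) (x y : J) : ℝ :=
  ∫ z, |W.toFun x z - W.toFun y z| ∂π

/-- The set `J`, to be equipped with the (semi)metric `r_W`. -/
def NbhdSpace (_W : Graphon π) : Type _ := J

/-- The identity map from `J` to `(J, r_W)`. -/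
def toNbhd (W : Graphon π) (x : J) : W.NbhdSpace := x

theorem integrable_section [IsProbabilityMeasure π] (W : Graphon π) (x : J) :
    Integrable (W.toFun x) π :=
  Integrable.of_mem_Icc 0 1 (W.aemeasurable_section x)
    (Filter.Eventually.of_forall (W.mem_Icc x))

/-- The space `(J, r_W)`. -/
instance [IsProbabilityMeasure π] (W : Graphon π) : PseudoMetricSpace W.NbhdSpace where
  dist := W.nbhdDist
  dist_self x := by simp [nbhdDist]
  dist_comm x y := by simp only [nbhdDist, abs_sub_comm]
  dist_triangle x y z := by
    have h : ∀ a b, Integrable (fun t => |W.toFun a t - W.toFun b t|) π := fun a b =>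
      ((W.integrable_section a).sub (W.integrable_section b)).abs
    simp only [nbhdDist]
    rw [← integral_add (h x y) (h y z)]
    exact integral_mono (h x z) ((h x y).add (h y z)) (fun t => abs_sub_le _ _ _)

/-- `(J, W)` is pure: `(J, r_W)` is a complete metric space, and `π` has full support in it. -/
structure IsPure [IsProbabilityMeasure π] (W : Graphon π) : Prop where
  eq_of_nbhdDist_eq_zero : ∀ x y, W.nbhdDist x y = 0 → x = y
  complete : CompleteSpace W.NbhdSpace
  full_support : ∀ U : Set W.NbhdSpace, IsOpen U → U.Nonempty → 0 < π (W.toNbhd ⁻¹' U)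

/-- A measure preserving bijection `σ` of `J` is an automorphism of `(J, W)` if for every `x`,
`W(σ x, σ y) = W(x, y)` for almost all `y`. -/
structure IsAutomorphism (W : Graphon π) (σ : J ≃ J) : Prop where
  measurePreserving : MeasurePreserving σ π π
  map_eq : ∀ x, ∀ᵐ y ∂π, W.toFun (σ x) (σ y) = W.toFun x y

/-- The automorphism group of `(J, W)` is transitive on `J`. -/
def IsTransitive (W : Graphon π) : Prop :=
  ∀ x y : J, ∃ σ : J ≃ J, W.IsAutomorphism σ ∧ σ x = y

/-- The operator square `(W ∘ W)(x,y) = ∫ W(x,z) W(z,y) dπ(z)`. -/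
def opSquare [IsProbabilityMeasure π] (W : Graphon π) : Graphon π where
  toFun x y := ∫ z, W.toFun x z * W.toFun z y ∂π
  symm x y := by
    congr 1
    funext z
    rw [W.symm x z, W.symm z y, mul_comm]
  mem_Icc x y := by
    have h0 : ∀ z, 0 ≤ W.toFun x z * W.toFun z y := fun z =>
      mul_nonneg (W.mem_Icc x z).1 (W.mem_Icc z y).1
    have h1 : ∀ z, W.toFun x z * W.toFun z y ≤ 1 := fun z =>
      mul_le_one₀ (W.mem_Icc x z).2 (W.mem_Icc z y).1 (W.mem_Icc z y).2
    refine ⟨integral_nonneg h0, ?_⟩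
    calc ∫ z, W.toFun x z * W.toFun z y ∂π ≤ ∫ _, (1 : ℝ) ∂π :=
          integral_mono_of_nonneg (Filter.Eventually.of_forall h0) (integrable_const 1)
            (Filter.Eventually.of_forall h1)
      _ = 1 := by simp
  aemeasurable := by
    have h1 : AEMeasurable (fun p : (J × J) × J => W.toFun p.1.1 p.2) ((π.prod π).prod π) :=
      W.aemeasurable.comp_quasiMeasurePreserving
        ((measurePreserving_fst (μ := π) (ν := π)).prod
          (MeasurePreserving.id π)).quasiMeasurePreserving
    have h2 : AEMeasurable (fun p : (J × J) × J => W.toFun p.1.2 p.2) ((π.prod π).prod π) :=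
      W.aemeasurable.comp_quasiMeasurePreserving
        ((measurePreserving_snd (μ := π) (ν := π)).prod
          (MeasurePreserving.id π)).quasiMeasurePreserving
    have h := (h1.mul h2).aestronglyMeasurable.integral_prod_right'.aemeasurable
    refine h.congr (Filter.Eventually.of_forall fun p => ?_)
    simp only [Pi.mul_apply, Function.uncurry, W.symm p.2]
  aemeasurable_section x := by
    have h1 : AEMeasurable (fun p : J × J => W.toFun x p.2) (π.prod π) :=
      (W.aemeasurable_section x).comp_quasiMeasurePreserving Measure.quasiMeasurePreserving_snd
    have h := (h1.mul W.aemeasurable).aestronglyMeasurable.integral_prod_right'.aemeasurable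
    refine h.congr (Filter.Eventually.of_forall fun y => ?_)
    simp only [Pi.mul_apply, Function.uncurry, W.symm y]

/-- The completion of `J` in the `2`-neighborhood metric, which is the neighborhood
distance of the operator square of `W`. -/
abbrev Jbar [IsProbabilityMeasure π] (W : Graphon π) : Type _ :=
  UniformSpace.Completion W.opSquare.NbhdSpace

/-- The canonical map from `J` to its completion in the `2`-neighborhood metric. -/
def toJbar [IsProbabilityMeasure π] (W : Graphon π) (x : J) : W.Jbar :=
  ((W.opSquare.toNbhd x : W.opSquare.NbhdSpace) : UniformSpace.Completion W.opSquare.NbhdSpace)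

end

end Graphon

namespace Graphon

variable {J : Type*} [MeasurableSpace J] {π : Measure J}

/-! Automorphisms are `r_W`-isometries preserving `π`, so under transitivity all balls of one radius
have equal measure, positive by purity. Finite total mass then forbids infinite separated sets: `J`
is totally bounded, hence compact (`IsPure.compactSpace`). As `r_{W∘W} ≤ r_W`, the map to `Jbar` is
continuous with compact dense image, hence onto; it is injective because `r_{W∘W}` separates points
(`IsPure.eq_of_nbhdDist_opSquare_eq_zero`). -/

theorem IsAutomorphism.nbhdDist_eq [IsProbabilityMeasure π] {W : Graphon π} {σ : J ≃ J}
    (h : W.IsAutomorphism σ) (x y : J) : W.nbhdDist (σ x) (σ y) = W.nbhdDist x y := by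
  have hσ := h.measurePreserving
  have hm : AEStronglyMeasurable (fun z => |W.toFun (σ x) z - W.toFun (σ y) z|)
      (Measure.map σ π) := by
    rw [hσ.map_eq]
    exact ((W.integrable_section _).sub (W.integrable_section _)).abs.aestronglyMeasurable
  calc W.nbhdDist (σ x) (σ y)
      = ∫ z, |W.toFun (σ x) z - W.toFun (σ y) z| ∂(Measure.map σ π) := by
        rw [hσ.map_eq, nbhdDist]
    _ = ∫ z, |W.toFun (σ x) (σ z) - W.toFun (σ y) (σ z)| ∂π :=
        integral_map hσ.measurable.aemeasurable hm
    _ = W.nbhdDist x y := by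
        refine integral_congr_ae ?_
        filter_upwards [h.map_eq x, h.map_eq y] with z hx hy
        rw [hx, hy]

theorem aemeasurable_nbhdDist [IsProbabilityMeasure π] (W : Graphon π) (x : J) :
    AEMeasurable (W.nbhdDist x) π := by
  have h1 : AEMeasurable (fun p : J × J => W.toFun x p.2) (π.prod π) :=
    (W.aemeasurable_section x).comp_quasiMeasurePreserving Measure.quasiMeasurePreserving_snd
  exact (h1.sub W.aemeasurable).aestronglyMeasurable.norm.integral_prod_right'.aemeasurable

/-- The σ-algebra of `J` is not assumed to contain the `r_W`-open sets; Fubini still makes balls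
null measurable, which suffices for invariance and additivity. -/
theorem nullMeasurableSet_nbhdDist_lt [IsProbabilityMeasure π] (W : Graphon π) (x : J) (ε : ℝ) :
    NullMeasurableSet {y | W.nbhdDist x y < ε} π :=
  nullMeasurableSet_lt (W.aemeasurable_nbhdDist x) aemeasurable_const

/-- An automorphism preserves the measure of balls. -/
theorem IsAutomorphism.measure_ball_eq [IsProbabilityMeasure π] {W : Graphon π} {σ : J ≃ J}
    (h : W.IsAutomorphism σ) (x : J) (ε : ℝ) :
    π {z | W.nbhdDist x z < ε} = π {z | W.nbhdDist (σ x) z < ε} := by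
  rw [← h.measurePreserving.measure_preimage (W.nullMeasurableSet_nbhdDist_lt (σ x) ε)]
  simp only [Set.preimage_ofPred_eq, h.nbhdDist_eq]

theorem IsPure.measure_ball_pos [IsProbabilityMeasure π] {W : Graphon π} (hW : W.IsPure)
    (x : J) {ε : ℝ} (hε : 0 < ε) : 0 < π {y | W.nbhdDist x y < ε} := by
  have h := hW.full_support (Metric.ball (W.toNbhd x) ε) Metric.isOpen_ball
    ⟨_, Metric.mem_ball_self hε⟩
  have he : W.toNbhd ⁻¹' Metric.ball (W.toNbhd x) ε = {y | W.nbhdDist x y < ε} := by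
    ext y
    exact Metric.mem_ball' (α := W.NbhdSpace)
  rwa [he] at h

/-- All balls of a given radius have the same positive measure, so `(J, r_W)` is totally bounded. -/
theorem IsPure.totallyBounded_univ [IsProbabilityMeasure π] {W : Graphon π} (hW : W.IsPure)
    (htrans : W.IsTransitive) : TotallyBounded (Set.univ : Set W.NbhdSpace) := by
  rw [Metric.totallyBounded_iff]
  intro ε hε
  by_contra! hcon
  -- Without a finite `ε`-net, greedy choice yields an infinite `ε`-separated sequence.
  obtain ⟨u, -, hu⟩ := exists_seq_of_forall_finset_exists (α := W.NbhdSpace) (fun _ => True)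
    (fun a b => ε ≤ dist a b) (fun s _ => by
      have := hcon s s.finite_toSet
      rw [Set.not_subset] at this
      obtain ⟨y, -, hy⟩ := this
      refine ⟨y, trivial, fun x hx => ?_⟩
      by_contra! hlt
      exact hy (Set.mem_biUnion (Finset.mem_coe.2 hx) (Metric.mem_ball'.2 hlt)))
  let B : ℕ → Set J := fun n => {y | W.nbhdDist (u n) y < ε / 2}
  have hdisj : Pairwise (Function.onFun Disjoint B) := by
    refine (pairwise_disjoint_on B).2 fun m n hmn => Set.disjoint_left.2 fun z hzm hzn => ?_
    have h1 : dist (u m) (W.toNbhd z) < ε / 2 := hzm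
    have h2 : dist (u n) (W.toNbhd z) < ε / 2 := hzn
    have h3 := dist_triangle_right (u m) (u n) (W.toNbhd z)
    linarith [hu m n hmn]
  have hconst : ∀ n, π (B n) = π (B 0) := fun n => by
    obtain ⟨σ, hσ, hx⟩ := htrans (u n) (u 0)
    have := hσ.measure_ball_eq (u n) (ε / 2)
    rwa [hx] at this
  have hsum : ∑' n, π (B n) = π (⋃ n, B n) :=
    (measure_iUnion₀ (hdisj.mono fun _ _ h => h.aedisjoint)
      fun n => W.nullMeasurableSet_nbhdDist_lt (u n) _).symm
  simp only [hconst] at hsum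
  rw [ENNReal.tsum_const_eq_top_of_ne_zero (hW.measure_ball_pos (u 0) (half_pos hε)).ne'] at hsum
  exact measure_ne_top π _ hsum.symm

theorem IsPure.compactSpace [IsProbabilityMeasure π] {W : Graphon π} (hW : W.IsPure)
    (htrans : W.IsTransitive) : CompactSpace W.NbhdSpace :=
  haveI := hW.complete
  ⟨(hW.totallyBounded_univ htrans).isCompact_of_isClosed isClosed_univ⟩

theorem integrable_sub_mul [IsProbabilityMeasure π] (W : Graphon π) (x y t : J) :
    Integrable (fun z => (W.toFun x z - W.toFun y z) * W.toFun t z) π :=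
  ((W.integrable_section x).sub (W.integrable_section y)).mul_bdd (c := 1)
    (W.integrable_section t).aestronglyMeasurable
    (Filter.Eventually.of_forall fun z => by
      rw [Real.norm_eq_abs, abs_of_nonneg (W.mem_Icc t z).1]
      exact (W.mem_Icc t z).2)

theorem opSquare_sub [IsProbabilityMeasure π] (W : Graphon π) (x y t : J) :
    W.opSquare.toFun x t - W.opSquare.toFun y t =
      ∫ z, (W.toFun x z - W.toFun y z) * W.toFun t z ∂π := by
  have h : ∀ a, Integrable (fun z => W.toFun a z * W.toFun z t) π := fun a => by
    simp only [W.symm _ t]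
    exact (W.integrable_section a).mul_bdd (c := 1)
      (W.integrable_section t).aestronglyMeasurable
      (Filter.Eventually.of_forall fun z => by
        rw [Real.norm_eq_abs, abs_of_nonneg (W.mem_Icc t z).1]
        exact (W.mem_Icc t z).2)
  simp only [opSquare]
  rw [← integral_sub (h x) (h y)]
  simp only [sub_mul, W.symm _ t]

/-- Uniformity in `t` serves twice: integrating over `t` compares the two metrics, and symmetry
makes `W ∘ W` 1-Lipschitz in its second variable. -/
theorem abs_opSquare_sub_le [IsProbabilityMeasure π] (W : Graphon π) (x y t : J) :
    |W.opSquare.toFun x t - W.opSquare.toFun y t| ≤ W.nbhdDist x y := by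
  rw [opSquare_sub]
  refine (abs_integral_le_integral_abs).trans (integral_mono (W.integrable_sub_mul x y t).abs
    ((W.integrable_section x).sub (W.integrable_section y)).abs fun z => ?_)
  simp only [abs_mul, abs_of_nonneg (W.mem_Icc t z).1]
  exact mul_le_of_le_one_right (abs_nonneg _) (W.mem_Icc t z).2

theorem nbhdDist_opSquare_le [IsProbabilityMeasure π] (W : Graphon π) (x y : J) :
    W.opSquare.nbhdDist x y ≤ W.nbhdDist x y := by
  calc W.opSquare.nbhdDist x y ≤ ∫ _, W.nbhdDist x y ∂π :=
        integral_mono ((W.opSquare.integrable_section x).sub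
          (W.opSquare.integrable_section y)).abs (integrable_const _)
          fun t => W.abs_opSquare_sub_le x y t
    _ = W.nbhdDist x y := by simp

theorem continuous_opSquare [IsProbabilityMeasure π] (W : Graphon π) (x : J) :
    Continuous (fun t : W.NbhdSpace => W.opSquare.toFun x t) := by
  refine (LipschitzWith.of_dist_le_mul (K := 1) fun s t => ?_).continuous
  rw [NNReal.coe_one, one_mul, Real.dist_eq, W.opSquare.symm x s, W.opSquare.symm x t]
  exact W.abs_opSquare_sub_le s t x

/-- In a pure graphon, the `2`-neighborhood distance separates points. -/
theorem IsPure.eq_of_nbhdDist_opSquare_eq_zero [IsProbabilityMeasure π] {W : Graphon π}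
    (hW : W.IsPure) {x y : J} (h : W.opSquare.nbhdDist x y = 0) : x = y := by
  have hae : ∀ᵐ t ∂π, W.opSquare.toFun x t - W.opSquare.toFun y t = 0 := by
    have := (integral_eq_zero_iff_of_nonneg (fun _ => abs_nonneg _)
      ((W.opSquare.integrable_section x).sub (W.opSquare.integrable_section y)).abs).1 h
    filter_upwards [this] with t ht
    exact abs_eq_zero.1 ht
  have hopen : IsOpen {t : W.NbhdSpace | W.opSquare.toFun x t - W.opSquare.toFun y t ≠ 0} :=
    isOpen_ne_fun ((W.continuous_opSquare x).sub (W.continuous_opSquare y)) continuous_const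
  -- By full support, a nonempty open set cannot be null, so the almost everywhere identity holds
  -- everywhere, in particular at `t = x` and `t = y`.
  have hall : ∀ t, W.opSquare.toFun x t - W.opSquare.toFun y t = 0 := by
    intro t
    by_contra ht
    exact (hW.full_support _ hopen ⟨t, ht⟩).ne' hae
  -- The square integral is the difference of the identities at `t = x` and `t = y`.
  have hsq : ∫ z, (W.toFun x z - W.toFun y z) ^ 2 ∂π = 0 := by
    have hx := hall x
    have hy := hall y
    rw [opSquare_sub] at hx hy
    have hsub := integral_sub (W.integrable_sub_mul x y x) (W.integrable_sub_mul x y y)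
    rw [hx, hy, sub_zero] at hsub
    rw [← hsub]
    congr 1
    funext z
    ring
  have hint : Integrable (fun z => (W.toFun x z - W.toFun y z) ^ 2) π :=
    ((W.integrable_sub_mul x y x).sub (W.integrable_sub_mul x y y)).congr
      (Filter.Eventually.of_forall fun z => by simp only [Pi.sub_apply]; ring)
  refine hW.eq_of_nbhdDist_eq_zero x y (integral_eq_zero_of_ae ?_)
  filter_upwards [(integral_eq_zero_iff_of_nonneg (fun _ => sq_nonneg _) hint).1 hsq] with z hz
  exact abs_eq_zero.2 (pow_eq_zero_iff two_ne_zero |>.1 hz)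

theorem IsPure.injective_toJbar [IsProbabilityMeasure π] {W : Graphon π} (hW : W.IsPure) :
    Function.Injective W.toJbar := by
  intro x y hxy
  apply hW.eq_of_nbhdDist_opSquare_eq_zero
  have h : dist (W.toJbar x) (W.toJbar y) = 0 := by rw [hxy, dist_self]
  rwa [toJbar, toJbar, UniformSpace.Completion.dist_eq] at h

theorem surjective_toJbar [IsProbabilityMeasure π] (W : Graphon π) [CompactSpace W.NbhdSpace] :
    Function.Surjective W.toJbar := by
  have hc : Continuous (fun x : W.NbhdSpace => W.toJbar x) := by
    refine (LipschitzWith.of_dist_le_mul (K := 1) fun s t => ?_).continuous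
    rw [NNReal.coe_one, one_mul]
    refine (UniformSpace.Completion.dist_eq (W.opSquare.toNbhd s) (W.opSquare.toNbhd t)).trans_le ?_
    exact W.nbhdDist_opSquare_le s t
  have hd : DenseRange W.toJbar :=
    UniformSpace.Completion.denseRange_coe (α := W.opSquare.NbhdSpace)
  -- A compact subset of the Hausdorff completion is closed; being dense, the range is everything.
  have hclosed : IsClosed (Set.range W.toJbar) := (isCompact_range hc).isClosed
  exact Set.range_eq_univ.1 (hclosed.closure_eq.symm.trans hd.closure_range)

end Graphon

theorem mainTheorem10 {J : Type*} [MeasurableSpace J] (π : Measure J)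
    [IsStandardProbabilitySpace π] (W : Graphon π) (hW : W.IsPure) (htrans : W.IsTransitive) :
    CompactSpace W.NbhdSpace ∧ Function.Bijective W.toJbar := by
  have hcompact := hW.compactSpace htrans
  exact ⟨hcompact, hW.injective_toJbar, W.surjective_toJbar⟩
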